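/- Let $n\ge 5$ and write the points of $\mathbb{R}^n$ as $(x,y)$ with $x\in\mathbb{R}$, $y\in\mathbb{R}^{n-1}$. Let $K\subset\mathbb{R}^n$ be an origin-symmetric convex body (compact, convex, with non-empty interior) that is a body of revolution about the $x$-axis and has an $(n-1)$-dimensional face perpendicular to this axis, normalized to have radius $1$ and height $1$: that is, $x\le 1$ on $K$ and $K\cap\{x=1\}=\{(1,y):\|y\|_2\le 1\}$. Consequently its norm (Minkowski functional) has the form \[ \|(x,y)\|_K=\begin{cases}|x| & \text{if } |x|>\|y\|_2,\\ g(x,\|y\|_2) & \text{if } |x|<\|y\|_2,\end{cases} \] with a function $g(x,r)$, defined for $|x|<|r|$ and even in $r$. Assume that 1. for every fixed $r\ne 0$ the function $x\mapsto g(x,r)$ has a continuous second derivative on $|x|<|r|$, and $\frac{\partial^2 g}{\partial x^2}(0,r)=0$; 2. $\lim_{x\to 0}\frac{\partial^2 g}{\partial x^2}(x,r)=0$, uniformly in $r$ on $\{|r|\ge r_0\}$ for every $r_0>0$. Then $K$ is not an intersection body. Here an origin-symmetric star body $K$, with radial function $\rho_K(\xi)=\max\{a : a\xi\in K\}$, is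 called an intersection body if there is an even non-negative finite Borel measure $\mu$ on $S^{n-1}$ such that $\int_{S^{n-1}}\rho_K(\xi)f(\xi)\,d\xi=\int_{S^{n-1}}Rf(\xi)\,d\mu(\xi)$ for every continuous $f$ on $S^{n-1}$, where $Rf(\xi)=\int_{S^{n-1}\cap\xi^\perp}f(\theta)\,d\theta$ is the spherical Radon transform. -/

import Mathlib

open MeasureTheory Metric Set Filter Topology

noncomputable section

/-- Surface measure of the unit sphere of a finite-dimensional Euclidean space `V`, built from the
Lebesgue measure of `V` that gives mass one to the cube of an orthonormal basis.  (The Lebesgue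
measure is written out, because for a subspace `V` of a larger space the instance `volume` could be
read as the restriction of the ambient volume, which is the zero measure.) -/
def surfaceMeasure (V : Type*) [NormedAddCommGroup V] [InnerProductSpace ℝ V]
    [FiniteDimensional ℝ V] [MeasurableSpace V] [BorelSpace V] : Measure (sphere (0 : V) 1) :=
  ((stdOrthonormalBasis ℝ V).toBasis.addHaar).toSphere

/-- The inclusion of the great subsphere `S ∩ ξ^⊥` in the unit sphere `S`. -/
def subsphereInclusion {n : ℕ} (ξ : sphere (0 : EuclideanSpace ℝ (Fin n)) 1)
    (θ : sphere (0 : (Submodule.span ℝ {(ξ : EuclideanSpace ℝ (Fin n))})ᗮ) 1) :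
    sphere (0 : EuclideanSpace ℝ (Fin n)) 1 :=
  ⟨((θ : (Submodule.span ℝ {(ξ : EuclideanSpace ℝ (Fin n))})ᗮ) : EuclideanSpace ℝ (Fin n)),
    mem_sphere_zero_iff_norm.2 (norm_eq_of_mem_sphere θ)⟩

/-- The spherical Radon transform `R g (ξ) = ∫_{S ∩ ξ^⊥} g(θ) dθ`. -/
def sphericalRadon {n : ℕ} (g : sphere (0 : EuclideanSpace ℝ (Fin n)) 1 → ℝ)
    (ξ : sphere (0 : EuclideanSpace ℝ (Fin n)) 1) : ℝ :=
  ∫ θ, g (subsphereInclusion ξ θ)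
    ∂(surfaceMeasure (Submodule.span ℝ {(ξ : EuclideanSpace ℝ (Fin n))})ᗮ)

/-- The radial function `ρ_K(ξ) = max {a : a ξ ∈ K}`. -/
def radialFunction {n : ℕ} (K : Set (EuclideanSpace ℝ (Fin n)))
    (ξ : sphere (0 : EuclideanSpace ℝ (Fin n)) 1) : ℝ :=
  sSup {a : ℝ | a • (ξ : EuclideanSpace ℝ (Fin n)) ∈ K}

/-- Origin-symmetric star bodies: compact sets that are star-shaped about the origin, symmetric
about it, contain it in their interior, and have a continuous radial function. -/
structure IsSymmStarBody {n : ℕ} (K : Set (EuclideanSpace ℝ (Fin n))) : Prop where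
  isCompact : IsCompact K
  starConvex : StarConvex ℝ 0 K
  symm : ∀ z ∈ K, -z ∈ K
  zero_mem_interior : (0 : EuclideanSpace ℝ (Fin n)) ∈ interior K
  continuous_radial : Continuous (radialFunction K)

/-- A star body `K` is an intersection body if its radial function is the spherical Radon
transform of an even non-negative finite Borel measure `μ` on the sphere, in the sense that
`∫ ρ_K g = ∫ R g dμ` for every continuous function `g` on the sphere. -/
def IsIntersectionBody {n : ℕ} (K : Set (EuclideanSpace ℝ (Fin n))) : Prop :=
  IsSymmStarBody K ∧
    ∃ μ : Measure (sphere (0 : EuclideanSpace ℝ (Fin n)) 1), IsFiniteMeasure μ ∧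
      Measure.map (fun ξ => -ξ) μ = μ ∧
      ∀ g : C(sphere (0 : EuclideanSpace ℝ (Fin n)) 1, ℝ),
        ∫ ξ, radialFunction K ξ * g ξ ∂(surfaceMeasure (EuclideanSpace ℝ (Fin n))) =
          ∫ ξ, sphericalRadon g ξ ∂μ

/-- Origin-symmetric convex bodies. -/
structure IsSymmConvexBody {n : ℕ} (K : Set (EuclideanSpace ℝ (Fin n))) : Prop where
  isCompact : IsCompact K
  convex : Convex ℝ K
  symm : ∀ z ∈ K, -z ∈ K
  interior_nonempty : (interior K).Nonempty

/- Points of `ℝ^(d+1)` are written `z = (x, y)` with `x = z 0` and `y` the other `d` coordinates. -/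

/-- The component `y ∈ ℝ^d` of `z = (x, y) ∈ ℝ^(d+1)`. -/
def yPart {d : ℕ} (z : EuclideanSpace ℝ (Fin (d + 1))) : EuclideanSpace ℝ (Fin d) :=
  WithLp.toLp 2 fun i => z i.succ

/-- `K` is invariant under all orthogonal maps that fix the `x`-axis pointwise. -/
def IsOfRevolution {d : ℕ} (K : Set (EuclideanSpace ℝ (Fin (d + 1)))) : Prop :=
  ∀ U : EuclideanSpace ℝ (Fin (d + 1)) ≃ₗᵢ[ℝ] EuclideanSpace ℝ (Fin (d + 1)),
    U (EuclideanSpace.single 0 1) = EuclideanSpace.single 0 1 → U '' K = K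

/-- The hyperplane `x = 1` supports `K` and cuts it in the face `{(1, y) : ‖y‖ ≤ 1}`: a
`d`-dimensional face perpendicular to the `x`-axis, of radius one and at height one. -/
def HasUnitFace {d : ℕ} (K : Set (EuclideanSpace ℝ (Fin (d + 1)))) : Prop :=
  (∀ z ∈ K, z 0 ≤ 1) ∧ {z | z ∈ K ∧ z 0 = 1} = {z | z 0 = 1 ∧ ‖yPart z‖ ≤ 1}

end

open scoped ENNReal NNReal BoundedContinuousFunction

/-! Write n = j + 4, so j ≥ 1, and test the intersection-body identity only on zonal functions φ(x).
On the sphere of ℝⁿ the coordinate x has density proportional to (1 - u²)^((j+1)/2)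
(`map_inner_surfaceMeasure`). On the great subsphere ξ^⊥ it is s times a coordinate with density
proportional to (1 - u²)^(j/2), where s = √(1 - ξ₀²) (`sphericalRadon_zonal`). With k(v) = (1 -
v²)₊^(j/2), comparing densities gives P(v) k(v) = ∫ k(v/s) dν for almost every v in (-1, 1). Here
P(v) = √(1 - v²) ρ_K(v), and ν is μ weighted by a constant multiple of 1/s
(`ae_eq_lintegral_of_forall_lintegral_eq`).

Near the equator P(v) = 1/G(v/√(1 - v²)) with G = g(·, 1). Since G is even and G''(0) = 0, P(0) -
P(v) is at most o(v²). But k(v/s) lies below k(v) by at least δv² whenever s ≤ t < 1, so any mass of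
ν there would force a quadratic drop of P. Hence s = 1 ν-almost everywhere and P is almost
everywhere constant (`exists_ae_eq_const_of_ae_eq_lintegral`). On the cone over the face, however,
P(v) = √(1 - v²)/v is strictly decreasing: a contradiction. -/

/-! ### Distribution of a coordinate on the unit sphere. -/

theorem lintegral_comp_smul_addHaar {E : Type*} [NormedAddCommGroup E] [NormedSpace ℝ E]
    [MeasurableSpace E] [BorelSpace E] [FiniteDimensional ℝ E] (μ : Measure E)
    [μ.IsAddHaarMeasure] {f : E → ℝ≥0∞} (hf : Measurable f) {r : ℝ} (hr : 0 < r) :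
    ∫⁻ x, f (r • x) ∂μ = ENNReal.ofReal (r⁻¹ ^ Module.finrank ℝ E) * ∫⁻ x, f x ∂μ := by
  rw [← lintegral_map hf (measurable_const_smul r), Measure.map_addHaar_smul μ hr.ne',
    lintegral_smul_measure, abs_of_nonneg (by positivity), inv_pow, smul_eq_mul]

theorem sqrt_mul_sq_add_sq {r : ℝ} (hr : 0 ≤ r) (w : ℝ) :
    √((r * w) ^ 2 + r ^ 2) = r * √(1 + w ^ 2) := by
  rw [show (r * w) ^ 2 + r ^ 2 = r ^ 2 * (1 + w ^ 2) by ring, Real.sqrt_mul (sq_nonneg r),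
    Real.sqrt_sq hr]

/-- Integration of a product of an angular and a radial function over `ℝ × ℝ^(m+2)`, in the
coordinate `w = t / ‖y‖`. -/
theorem lintegral_lintegral_angular_mul_radial (m : ℕ) {F h : ℝ → ℝ≥0∞} (hF : Measurable F)
    (hh : Measurable h) :
    ∫⁻ y : EuclideanSpace ℝ (Fin (m + 2)), ∫⁻ t : ℝ,
        F (t / √(t ^ 2 + ‖y‖ ^ 2)) * h (√(t ^ 2 + ‖y‖ ^ 2)) =
      (∫⁻ y : EuclideanSpace ℝ (Fin (m + 2)), ENNReal.ofReal ‖y‖ * h ‖y‖) *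
        ∫⁻ w : ℝ, F (w / √(1 + w ^ 2)) * ENNReal.ofReal ((√(1 + w ^ 2))⁻¹ ^ (m + 3)) := by
  have h1 : ∀ᵐ y : EuclideanSpace ℝ (Fin (m + 2)),
      ∫⁻ t : ℝ, F (t / √(t ^ 2 + ‖y‖ ^ 2)) * h (√(t ^ 2 + ‖y‖ ^ 2)) =
      ∫⁻ w : ℝ, F (w / √(1 + w ^ 2)) * (ENNReal.ofReal ‖y‖ * h (‖y‖ * √(1 + w ^ 2))) := by
    have : ∀ᵐ y : EuclideanSpace ℝ (Fin (m + 2)), y ≠ 0 := by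
      rw [ae_iff]; simp
    filter_upwards [this] with y hy
    have hy0 : 0 < ‖y‖ := norm_pos_iff.2 hy
    have := lintegral_comp_smul_addHaar (volume : Measure ℝ)
      (f := fun t => F (t / √(t ^ 2 + ‖y‖ ^ 2)) * h (√(t ^ 2 + ‖y‖ ^ 2)))
      (by fun_prop) hy0
    have h2 : ∀ w : ℝ, F (w / √(1 + w ^ 2)) * (ENNReal.ofReal ‖y‖ * h (‖y‖ * √(1 + w ^ 2))) =
        ENNReal.ofReal ‖y‖ * (F (w / √(1 + w ^ 2)) * h (‖y‖ * √(1 + w ^ 2))) := fun w => by ring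
    simp_rw [h2]
    rw [lintegral_const_mul _ (by fun_prop)]
    simp only [smul_eq_mul, sqrt_mul_sq_add_sq hy0.le, mul_div_mul_left _ _ hy0.ne',
      Module.finrank_self, pow_one] at this
    rw [this, ← mul_assoc, ← ENNReal.ofReal_mul hy0.le, mul_inv_cancel₀ hy0.ne']
    simp
  rw [lintegral_congr_ae h1, lintegral_lintegral_swap (by fun_prop),
    ← lintegral_const_mul _ (by fun_prop)]
  refine lintegral_congr fun w => ?_
  have hc : 0 < √(1 + w ^ 2) := by positivity
  rw [lintegral_const_mul _ (by fun_prop)]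
  have := lintegral_comp_smul_addHaar (volume : Measure (EuclideanSpace ℝ (Fin (m + 2))))
      (f := fun y => ENNReal.ofReal ‖y‖ * h ‖y‖) (by fun_prop) hc
  have h3 : ∀ y : EuclideanSpace ℝ (Fin (m + 2)),
      ENNReal.ofReal ‖y‖ * h (‖y‖ * √(1 + w ^ 2)) =
      ENNReal.ofReal (√(1 + w ^ 2))⁻¹ *
        (ENNReal.ofReal ‖√(1 + w ^ 2) • y‖ * h ‖√(1 + w ^ 2) • y‖) := fun y => by
    rw [norm_smul, Real.norm_of_nonneg hc.le, ← mul_assoc, ← ENNReal.ofReal_mul (by positivity),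
      inv_mul_cancel_left₀ hc.ne', mul_comm ‖y‖]
  simp_rw [h3]
  -- The exponent m + 3 is m + 2 from the dilation of ℝ^(m+2) plus one from the factor `‖y‖`.
  rw [lintegral_const_mul _ (by fun_prop), this, finrank_euclideanSpace_fin,
    show (√(1 + w ^ 2))⁻¹ ^ (m + 3) = (√(1 + w ^ 2))⁻¹ * (√(1 + w ^ 2))⁻¹ ^ (m + 2) by ring,
    ENNReal.ofReal_mul (by positivity)]
  ring

theorem one_sub_div_sqrt_sq (w : ℝ) : 1 - (w / √(1 + w ^ 2)) ^ 2 = ((√(1 + w ^ 2))⁻¹) ^ 2 := by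
  have : (0 : ℝ) < 1 + w ^ 2 := by positivity
  rw [div_pow, inv_pow, Real.sq_sqrt this.le]
  field_simp
  ring

theorem sqrt_one_sub_div_sqrt_sq (w : ℝ) :
    √(1 - (w / √(1 + w ^ 2)) ^ 2) = (√(1 + w ^ 2))⁻¹ := by
  rw [one_sub_div_sqrt_sq, Real.sqrt_sq (by positivity)]

theorem hasDerivAt_div_sqrt (w : ℝ) :
    HasDerivAt (fun w : ℝ => w / √(1 + w ^ 2)) ((√(1 + w ^ 2))⁻¹ ^ 3) w := by
  have h0 : (0 : ℝ) < 1 + w ^ 2 := by positivity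
  have hs : √(1 + w ^ 2) ^ 2 = 1 + w ^ 2 := Real.sq_sqrt h0.le
  have hc : 0 < √(1 + w ^ 2) := by positivity
  have h1 : HasDerivAt (fun w : ℝ => 1 + w ^ 2) (2 * w) w := by
    simpa using (hasDerivAt_pow 2 w).const_add 1
  refine ((hasDerivAt_id w).div (h1.sqrt h0.ne') hc.ne').congr_deriv ?_
  rw [id]
  field_simp
  rw [hs]
  ring

theorem div_sqrt_div_sqrt_one_sub {u : ℝ} (hu : u ∈ Ioo (-1 : ℝ) 1) :
    (u / √(1 - u ^ 2)) / √(1 + (u / √(1 - u ^ 2)) ^ 2) = u := by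
  have h0 : 0 < 1 - u ^ 2 := by nlinarith [hu.1, hu.2]
  have h1 : 1 + (u / √(1 - u ^ 2)) ^ 2 = (√(1 - u ^ 2))⁻¹ ^ 2 := by
    rw [div_pow, inv_pow, Real.sq_sqrt h0.le]; field_simp; ring
  have hc : 0 < √(1 - u ^ 2) := by positivity
  rw [h1, Real.sqrt_sq (by positivity)]
  field_simp

theorem image_div_sqrt : (fun w : ℝ => w / √(1 + w ^ 2)) '' univ = Ioo (-1) 1 := by
  ext u
  constructor
  · rintro ⟨w, -, rfl⟩
    have h := one_sub_div_sqrt_sq w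
    have h2 : 0 < ((√(1 + w ^ 2))⁻¹) ^ 2 := by positivity
    exact abs_lt.1 ((sq_lt_one_iff_abs_lt_one _).1 (by linarith))
  · exact fun hu => ⟨u / √(1 - u ^ 2), mem_univ _, div_sqrt_div_sqrt_one_sub hu⟩

theorem div_sqrt_injective : Function.Injective (fun w : ℝ => w / √(1 + w ^ 2)) := by
  intro a b hab
  have ha := sqrt_one_sub_div_sqrt_sq a
  have hb := sqrt_one_sub_div_sqrt_sq b
  simp only at hab
  rw [hab, hb, inv_inj] at ha
  rw [ha] at hab
  have hc : 0 < √(1 + a ^ 2) := by positivity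
  exact (div_left_inj' hc.ne').1 hab

/-- Substitution u = w/√(1 + w²): its derivative takes three of the m + 3 powers of (1 + w²)^(-1/2)
= √(1 - u²), leaving m. -/
theorem lintegral_gnomonic (m : ℕ) (F : ℝ → ℝ≥0∞) :
    ∫⁻ w : ℝ, F (w / √(1 + w ^ 2)) * ENNReal.ofReal ((√(1 + w ^ 2))⁻¹ ^ (m + 3)) =
      ∫⁻ u in Ioo (-1) 1, F u * ENNReal.ofReal (√(1 - u ^ 2) ^ m) := by
  rw [← image_div_sqrt, lintegral_image_eq_lintegral_abs_deriv_mul MeasurableSet.univ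
    (fun w _ => (hasDerivAt_div_sqrt w).hasDerivWithinAt) div_sqrt_injective.injOn,
    Measure.restrict_univ]
  refine lintegral_congr fun w => ?_
  rw [sqrt_one_sub_div_sqrt_sq, abs_of_nonneg (by positivity), mul_left_comm,
    ← ENNReal.ofReal_mul (by positivity)]
  congr 2
  ring

/-- The surface measure of a sphere of dimension `m + 2` has, in the direction of any fixed
diameter, the density `zonalConst m * (1 - u ^ 2) ^ (m / 2)`. -/
noncomputable def zonalConst (m : ℕ) : ℝ≥0∞ :=
  (m + 3 : ℕ) * ∫⁻ y : EuclideanSpace ℝ (Fin (m + 2)),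
    ENNReal.ofReal ‖y‖ * (Ioo (0 : ℝ) 1).indicator 1 ‖y‖

theorem norm_sq_eq_sq_add_yPart {d : ℕ} (z : EuclideanSpace ℝ (Fin (d + 1))) :
    ‖z‖ ^ 2 = z 0 ^ 2 + ‖yPart z‖ ^ 2 := by
  simp [EuclideanSpace.norm_sq_eq, Fin.sum_univ_succ, yPart]

theorem norm_eq_sqrt_yPart {d : ℕ} (z : EuclideanSpace ℝ (Fin (d + 1))) :
    ‖z‖ = √(z 0 ^ 2 + ‖yPart z‖ ^ 2) := by
  rw [← norm_sq_eq_sq_add_yPart, Real.sqrt_sq (norm_nonneg _)]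

theorem measurePreserving_zero_yPart (k : ℕ) :
    MeasurePreserving (fun z : EuclideanSpace ℝ (Fin (k + 1)) => (z 0, yPart z)) := by
  have h1 := PiLp.volume_preserving_ofLp (Fin (k + 1))
  have h2 := volume_preserving_piFinSuccAbove (fun _ : Fin (k + 1) => ℝ) 0
  have h3 := (MeasurePreserving.id (volume : Measure ℝ)).prod (PiLp.volume_preserving_toLp (Fin k))
  exact h3.comp (h2.comp h1)

theorem lintegral_euclideanSpace_succ (k : ℕ) {G : ℝ × EuclideanSpace ℝ (Fin k) → ℝ≥0∞}
    (hG : Measurable G) :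
    ∫⁻ z : EuclideanSpace ℝ (Fin (k + 1)), G (z 0, yPart z) = ∫⁻ y, ∫⁻ t, G (t, y) := by
  rw [(measurePreserving_zero_yPart k).lintegral_comp hG, Measure.volume_eq_prod,
    lintegral_prod_symm _ hG.aemeasurable]

section

variable {V : Type*} [NormedAddCommGroup V] [InnerProductSpace ℝ V]

theorem exists_orthonormalBasis_apply_zero [FiniteDimensional ℝ V] {k : ℕ} (hV : Module.finrank ℝ V = k + 1) {e : V}
    (he : ‖e‖ = 1) : ∃ b : OrthonormalBasis (Fin (k + 1)) ℝ V, b 0 = e := by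
  have h : Orthonormal ℝ (({0} : Set (Fin (k + 1))).domRestrict fun _ => e) := by
    rw [orthonormal_iff_ite]
    rintro ⟨i, hi⟩ ⟨j, hj⟩
    obtain rfl : i = 0 := hi
    obtain rfl : j = 0 := hj
    simp [he, Set.domRestrict]
  obtain ⟨b, hb⟩ := h.exists_orthonormalBasis_extension_of_card_eq (by simp [hV])
  exact ⟨b, hb 0 rfl⟩

open scoped Pointwise in
-- `toSphere` measures a set by the volume of the open cone over it. In this form that volume is an
-- integral of an angular times a radial function.
theorem Ioo_smul_image_preimage_inner (e : V) (B : Set ℝ) :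
    Ioo (0 : ℝ) 1 • (((↑) : sphere (0 : V) 1 → V) '' ((fun θ => inner ℝ e (θ : V)) ⁻¹' B)) =
      {z | inner ℝ e z / ‖z‖ ∈ B ∧ ‖z‖ ∈ Ioo (0 : ℝ) 1} := by
  ext z
  constructor
  · rintro ⟨r, hr, -, ⟨θ, hθ, rfl⟩, rfl⟩
    have hn : ‖r • (θ : V)‖ = r := by
      rw [norm_smul, norm_eq_of_mem_sphere θ, mul_one, Real.norm_of_nonneg hr.1.le]
    refine ⟨?_, by simpa only [hn] using hr⟩
    have : inner ℝ e (r • (θ : V)) / ‖r • (θ : V)‖ = inner ℝ e (θ : V) := by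
      rw [hn, inner_smul_right, mul_div_cancel_left₀ _ hr.1.ne']
    rw [this]
    exact hθ
  · rintro ⟨hB, hz⟩
    refine ⟨‖z‖, hz, ‖z‖⁻¹ • z, ⟨⟨‖z‖⁻¹ • z, ?_⟩, ?_, rfl⟩, ?_⟩
    · rw [mem_sphere_zero_iff_norm, norm_smul, norm_inv, norm_norm, inv_mul_cancel₀ hz.1.ne']
    · simpa [inner_smul_right, div_eq_inv_mul] using hB
    · simp only [smul_inv_smul₀ hz.1.ne']

variable [FiniteDimensional ℝ V] [MeasurableSpace V] [BorelSpace V]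

/-- Distribution of a coordinate on the unit sphere. -/
theorem map_inner_surfaceMeasure {m : ℕ} (hV : Module.finrank ℝ V = m + 3) {e : V}
    (he : ‖e‖ = 1) :
    Measure.map (fun θ : sphere (0 : V) 1 => inner ℝ e (θ : V)) (surfaceMeasure V) =
      zonalConst m • (volume.restrict (Ioo (-1) 1)).withDensity
        (fun u => ENNReal.ofReal (√(1 - u ^ 2) ^ m)) := by
  ext B hB
  have hmeas : Measurable (fun θ : sphere (0 : V) 1 => inner ℝ e (θ : V)) := by fun_prop
  obtain ⟨b, hb⟩ := exists_orthonormalBasis_apply_zero hV he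
  have hA : MeasurableSet {z : V | inner ℝ e z / ‖z‖ ∈ B ∧ ‖z‖ ∈ Ioo (0 : ℝ) 1} :=
    (((by fun_prop : Measurable fun z : V => inner ℝ e z / ‖z‖)) hB).inter
      (measurable_norm measurableSet_Ioo)
  rw [Measure.map_apply hmeas hB, surfaceMeasure, Measure.toSphere_apply' _ (hmeas hB),
    Ioo_smul_image_preimage_inner, OrthonormalBasis.addHaar_eq_volume, hV,
    ← b.measurePreserving_repr_symm.measure_preimage hA.nullMeasurableSet,
    ← lintegral_indicator_one (b.repr.symm.continuous.measurable hA)]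
  have hF : Measurable (B.indicator (1 : ℝ → ℝ≥0∞)) := measurable_one.indicator hB
  have hh : Measurable ((Ioo (0 : ℝ) 1).indicator (1 : ℝ → ℝ≥0∞)) :=
    measurable_one.indicator measurableSet_Ioo
  have key : ∀ z : EuclideanSpace ℝ (Fin (m + 3)),
      (b.repr.symm ⁻¹' {z : V | inner ℝ e z / ‖z‖ ∈ B ∧ ‖z‖ ∈ Ioo (0 : ℝ) 1}).indicator
        (1 : EuclideanSpace ℝ (Fin (m + 3)) → ℝ≥0∞) z = B.indicator 1 (z 0 / √(z 0 ^ 2 + ‖yPart z‖ ^ 2)) *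
        (Ioo (0 : ℝ) 1).indicator 1 (√(z 0 ^ 2 + ‖yPart z‖ ^ 2)) := fun z => by
    have h0 : inner ℝ e (b.repr.symm z) = z 0 := by
      rw [← hb, ← b.repr_apply_apply, LinearIsometryEquiv.apply_symm_apply]
    rw [← norm_eq_sqrt_yPart]
    have hm : z ∈ b.repr.symm ⁻¹' {z : V | inner ℝ e z / ‖z‖ ∈ B ∧ ‖z‖ ∈ Ioo (0 : ℝ) 1} ↔
        z 0 / ‖z‖ ∈ B ∧ ‖z‖ ∈ Ioo (0 : ℝ) 1 := by
      rw [mem_preimage, mem_ofPred_eq, h0, LinearIsometryEquiv.norm_map]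
    by_cases h1 : z 0 / ‖z‖ ∈ B
    · by_cases h2 : ‖z‖ ∈ Ioo (0 : ℝ) 1
      · rw [indicator_of_mem (hm.2 ⟨h1, h2⟩), indicator_of_mem h1, indicator_of_mem h2]
        simp
      · rw [indicator_of_notMem fun h => h2 (hm.1 h).2, indicator_of_notMem h2, mul_zero]
    · rw [indicator_of_notMem fun h => h1 (hm.1 h).1, indicator_of_notMem h1, zero_mul]
  rw [lintegral_congr key]
  rw [lintegral_euclideanSpace_succ (m + 2) (G := fun p => B.indicator 1
      (p.1 / √(p.1 ^ 2 + ‖p.2‖ ^ 2)) * (Ioo (0 : ℝ) 1).indicator 1 (√(p.1 ^ 2 + ‖p.2‖ ^ 2)))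
      (by fun_prop), lintegral_lintegral_angular_mul_radial m hF hh, lintegral_gnomonic,
    Measure.smul_apply, withDensity_apply _ hB, ← mul_assoc, smul_eq_mul, zonalConst,
    ← lintegral_indicator hB]
  congr 1
  refine lintegral_congr fun u => ?_
  by_cases hu : u ∈ B <;> simp [hu]

theorem lintegral_surfaceMeasure_inner {m : ℕ} (hV : Module.finrank ℝ V = m + 3) {e : V}
    (he : ‖e‖ = 1) {F : ℝ → ℝ≥0∞} (hF : Measurable F) :
    ∫⁻ θ, F (inner ℝ e (θ : V)) ∂surfaceMeasure V =
      zonalConst m * ∫⁻ u in Ioo (-1) 1, ENNReal.ofReal (√(1 - u ^ 2) ^ m) * F u := by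
  rw [← lintegral_map (f := F) hF (g := fun θ : sphere (0 : V) 1 => inner ℝ e (θ : V))
    (by fun_prop), map_inner_surfaceMeasure hV he, lintegral_smul_measure,
    lintegral_withDensity_eq_lintegral_mul _ (by fun_prop) hF]
  rfl

end

theorem zonalConst_ne_top (m : ℕ) : zonalConst m ≠ ∞ := by
  refine ENNReal.mul_ne_top (ENNReal.natCast_ne_top _) (ne_of_lt ?_)
  calc ∫⁻ y : EuclideanSpace ℝ (Fin (m + 2)),
        ENNReal.ofReal ‖y‖ * (Ioo (0 : ℝ) 1).indicator 1 ‖y‖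
      ≤ ∫⁻ y : EuclideanSpace ℝ (Fin (m + 2)), (ball 0 1).indicator 1 y := by
        refine lintegral_mono fun y => ?_
        by_cases hy : ‖y‖ ∈ Ioo (0 : ℝ) 1
        · simpa [indicator_of_mem hy, hy.2] using ENNReal.ofReal_le_one.2 hy.2.le
        · simp [indicator_of_notMem hy]
    _ < ∞ := by
        rw [lintegral_indicator_one measurableSet_ball]
        exact measure_ball_lt_top

theorem zonalConst_ne_zero (m : ℕ) : zonalConst m ≠ 0 := by
  intro h
  have hV : Module.finrank ℝ (EuclideanSpace ℝ (Fin (m + 3))) = m + 3 := by simp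
  have h1 := lintegral_surfaceMeasure_inner hV (e := EuclideanSpace.single 0 1) (by simp)
    (F := fun _ => 1) measurable_const
  rw [h, zero_mul, lintegral_one, Measure.measure_univ_eq_zero, surfaceMeasure] at h1
  exact Measure.toSphere_ne_zero _ h1

/-! ### Rigidity of the integral equation P(v) k(v) = ∫ k(v/s) dν. -/

theorem exists_mem_Ioo_of_ae_restrict {p : ℝ → Prop} {S : Set ℝ}
    (hp : ∀ᵐ v ∂volume.restrict S, p v) {a b : ℝ} (hab : a < b) (hS : Ioo a b ⊆ S) :
    ∃ v ∈ Ioo a b, p v := by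
  have h := ae_restrict_of_ae_restrict_of_subset hS hp
  have : NeBot (ae (volume.restrict (Ioo a b))) := by
    rw [ae_neBot, Ne, Measure.restrict_eq_zero, Real.volume_Ioo]
    simpa using hab
  obtain ⟨v, hv, hv'⟩ := (h.and (ae_restrict_mem measurableSet_Ioo)).exists
  exact ⟨v, hv', hv⟩

theorem sqrt_one_sub_div_sq_le {s t v : ℝ} (hs : 0 < s) (hst : s ≤ t) :
    √(1 - (v / s) ^ 2) ≤ √(1 - (v / t) ^ 2) := by
  refine Real.sqrt_le_sqrt (sub_le_sub_left ?_ _)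
  rw [div_pow, div_pow]
  gcongr

/-- With A, D the roots for 1 and t, (A - D)(A + D) = (1/t² - 1)v² and A + D ≤ 2 give the gap for j
= 1. Multiplying by A^(j-1), where A ≥ 1/2, gives it for all j ≥ 1; for j = 0 there is no gap. -/
theorem le_sqrt_pow_sub_sqrt_pow {j : ℕ} (hj : 1 ≤ j) {s t v : ℝ} (hs : 0 < s) (hst : s ≤ t)
    (ht : t < 1) (hvt : |v| ≤ t) (hv : |v| ≤ 1 / 2) :
    √(1 - (v / s) ^ 2) ^ j + (1 / 2) ^ (j - 1) * ((1 / t ^ 2 - 1) / 2) * v ^ 2 ≤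
      √(1 - v ^ 2) ^ j := by
  have ht0 : 0 < t := hs.trans_le hst
  obtain ⟨i, rfl⟩ : ∃ i, j = i + 1 := ⟨j - 1, by omega⟩
  rw [Nat.add_sub_cancel]
  have hv2 : v ^ 2 ≤ 1 / 4 := by
    rw [← sq_abs]; nlinarith [abs_nonneg v]
  set A := √(1 - v ^ 2) with hA
  set B := √(1 - (v / s) ^ 2) with hB
  set D := √(1 - (v / t) ^ 2) with hD
  have hBD : B ≤ D := sqrt_one_sub_div_sq_le hs hst
  have hA2 : A ^ 2 = 1 - v ^ 2 := Real.sq_sqrt (by linarith)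
  have hD2 : D ^ 2 = 1 - v ^ 2 * (1 / t ^ 2) := by
    rw [hD, Real.sq_sqrt, div_pow]
    · ring
    · rw [sub_nonneg, sq_le_one_iff_abs_le_one, abs_div, abs_of_pos ht0]
      exact (div_le_one ht0).2 hvt
  have hA0 : 0 ≤ A := Real.sqrt_nonneg _
  have hB0 : 0 ≤ B := Real.sqrt_nonneg _
  have hD0 : 0 ≤ D := Real.sqrt_nonneg _
  have hA1 : A ≤ 1 := by nlinarith
  have hAh : 1 / 2 ≤ A := by nlinarith
  have hDA : D ≤ A := by simpa using sqrt_one_sub_div_sq_le (v := v) ht0 ht.le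
  have ht2 : 0 ≤ 1 / t ^ 2 - 1 := by
    rw [sub_nonneg, one_le_div (by positivity)]
    exact pow_le_one₀ ht0.le ht.le
  have hgap : (1 / t ^ 2 - 1) / 2 * v ^ 2 ≤ A - B := by
    have h1 : (1 / t ^ 2 - 1) * v ^ 2 = (A - D) * (A + D) := by nlinarith
    have h2 : (A - D) * (A + D) ≤ (A - D) * 2 :=
      mul_le_mul_of_nonneg_left (by linarith) (by linarith)
    linarith
  have hpow : B ^ i ≤ A ^ i := pow_le_pow_left₀ hB0 (hBD.trans hDA) i
  have hhalf : (1 / 2 : ℝ) ^ i ≤ A ^ i := pow_le_pow_left₀ (by norm_num) hAh i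
  calc B ^ (i + 1) + (1 / 2) ^ i * ((1 / t ^ 2 - 1) / 2) * v ^ 2
      = B ^ i * B + (1 / 2) ^ i * ((1 / t ^ 2 - 1) / 2 * v ^ 2) := by ring
    _ ≤ A ^ i * B + A ^ i * (A - B) := by gcongr
    _ = A ^ (i + 1) := by ring

section

variable {Ω : Type*} [MeasurableSpace Ω] {ν : Measure Ω} {s : Ω → ℝ} {j : ℕ} {P : ℝ → ℝ}

/-- Fatou's lemma along points v → 0 at which the equation holds, since k(v/s) → 1 for each s. -/
theorem measure_univ_le_of_ae_eq_lintegral (hP : ContinuousAt P 0) (hs : Measurable s)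
    (h : ∀ᵐ v ∂volume.restrict (Ioo (-1) 1), ENNReal.ofReal (P v * √(1 - v ^ 2) ^ j) =
      ∫⁻ ω, ENNReal.ofReal (√(1 - (v / s ω) ^ 2) ^ j) ∂ν) :
    ν univ ≤ ENNReal.ofReal (P 0) := by
  have hex : ∀ n : ℕ, ∃ v ∈ Ioo (0 : ℝ) (1 / (n + 1)), ENNReal.ofReal (P v * √(1 - v ^ 2) ^ j) =
      ∫⁻ ω, ENNReal.ofReal (√(1 - (v / s ω) ^ 2) ^ j) ∂ν := fun n => by
    refine exists_mem_Ioo_of_ae_restrict h (by positivity) (Ioo_subset_Ioo (by norm_num) ?_)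
    exact (div_le_one (by positivity)).2 (by linarith [n.cast_nonneg (α := ℝ)])
  choose v hv hvint using hex
  have hv0 : Tendsto v atTop (𝓝 0) :=
    squeeze_zero (fun n => (hv n).1.le) (fun n => (hv n).2.le) tendsto_one_div_add_atTop_nhds_zero_nat
  have hlim : Tendsto (fun n => ENNReal.ofReal (P (v n) * √(1 - v n ^ 2) ^ j)) atTop
      (𝓝 (ENNReal.ofReal (P 0))) := by
    have : ContinuousAt (fun x => P x * √(1 - x ^ 2) ^ j) 0 := by fun_prop
    have h2 := ENNReal.tendsto_ofReal (this.tendsto.comp hv0)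
    simpa [Function.comp_def] using h2
  have hω : ∀ ω, liminf (fun n => ENNReal.ofReal (√(1 - (v n / s ω) ^ 2) ^ j)) atTop = 1 := by
    intro ω
    have : Continuous (fun x => √(1 - (x / s ω) ^ 2) ^ j) := by fun_prop
    have h2 := ENNReal.tendsto_ofReal ((this.tendsto 0).comp hv0)
    simp only [zero_div, ne_eq, OfNat.ofNat_ne_zero, not_false_eq_true, zero_pow, sub_zero,
      Real.sqrt_one, one_pow, ENNReal.ofReal_one] at h2
    exact h2.liminf_eq
  calc ν univ = ∫⁻ ω, liminf (fun n => ENNReal.ofReal (√(1 - (v n / s ω) ^ 2) ^ j)) atTop ∂ν := by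
        simp_rw [hω]; simp
    _ ≤ liminf (fun n => ∫⁻ ω, ENNReal.ofReal (√(1 - (v n / s ω) ^ 2) ^ j) ∂ν) atTop :=
        lintegral_liminf_le fun n => by fun_prop
    _ = ENNReal.ofReal (P 0) := by
        simp_rw [← hvint]
        exact hlim.liminf_eq

/-- The equation and ν(univ) ≤ P(0) give P(v)k(v) + δv² ν{s ≤ t} ≤ P(0)k(v), while P(0) - P(v) ≤
ηv². Cancel v² and let η → 0. -/
theorem measure_le_eq_zero_of_ae_eq_lintegral (hj : 1 ≤ j) (hP : ContinuousAt P 0)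
    (hP0 : ∀ v, 0 ≤ P v) (hs : Measurable s) (hs01 : ∀ᵐ ω ∂ν, s ω ∈ Ioc 0 1)
    (h : ∀ᵐ v ∂volume.restrict (Ioo (-1) 1), ENNReal.ofReal (P v * √(1 - v ^ 2) ^ j) =
      ∫⁻ ω, ENNReal.ofReal (√(1 - (v / s ω) ^ 2) ^ j) ∂ν)
    (hsmall : ∀ η > 0, ∀ᶠ v in 𝓝 0, P 0 - P v ≤ η * v ^ 2) {t : ℝ} (ht : t ∈ Ioo (0 : ℝ) 1) :
    ν {ω | s ω ≤ t} = 0 := by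
  set δ : ℝ := (1 / 2) ^ (j - 1) * ((1 / t ^ 2 - 1) / 2) with hδ
  have hδ0 : 0 < δ := by
    have : 0 < 1 / t ^ 2 - 1 := by
      rw [sub_pos, one_lt_div (pow_pos ht.1 2)]
      exact pow_lt_one₀ ht.1.le ht.2 two_ne_zero
    positivity
  have hmain : ∀ η > 0, ENNReal.ofReal δ * ν {ω | s ω ≤ t} ≤ ENNReal.ofReal η := by
    intro η hη
    obtain ⟨ε, hε, hball⟩ := Metric.eventually_nhds_iff.1 (hsmall η hη)
    obtain ⟨v, hv, hvint⟩ := exists_mem_Ioo_of_ae_restrict h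
      (a := 0) (b := min ε (min t (1 / 2))) (by
        have := ht.1
        positivity) (Ioo_subset_Ioo (by norm_num) (by
        exact (min_le_right _ _).trans ((min_le_right _ _).trans (by norm_num))))
    obtain ⟨hv0, hv1⟩ := hv
    rw [lt_min_iff, lt_min_iff] at hv1
    obtain ⟨hvε, hvt, hvh⟩ := hv1
    have habs : |v| = v := abs_of_pos hv0
    have hPv : P 0 - P v ≤ η * v ^ 2 := hball (by rwa [Real.dist_0_eq_abs, habs])
    have hset : MeasurableSet {ω | s ω ≤ t} := measurableSet_le hs measurable_const
    have hk0 : 0 ≤ √(1 - v ^ 2) ^ j := by positivity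
    have hk1 : √(1 - v ^ 2) ^ j ≤ 1 :=
      pow_le_one₀ (Real.sqrt_nonneg _) (Real.sqrt_le_one.2 (by nlinarith))
    have hle : ENNReal.ofReal (P v * √(1 - v ^ 2) ^ j) +
        ENNReal.ofReal (δ * v ^ 2) * ν {ω | s ω ≤ t} ≤
        ENNReal.ofReal (P 0 * √(1 - v ^ 2) ^ j) := by
      calc _ = ∫⁻ ω, (ENNReal.ofReal (√(1 - (v / s ω) ^ 2) ^ j) +
            {ω | s ω ≤ t}.indicator (fun _ => ENNReal.ofReal (δ * v ^ 2)) ω) ∂ν := by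
            rw [lintegral_add_left (by fun_prop), hvint, lintegral_indicator_const hset]
        _ ≤ ∫⁻ _, ENNReal.ofReal (√(1 - v ^ 2) ^ j) ∂ν := by
            refine lintegral_mono_ae ?_
            filter_upwards [hs01] with ω hω
            by_cases hωt : s ω ≤ t
            · rw [indicator_of_mem (by exact hωt), ← ENNReal.ofReal_add (by positivity)
                (by positivity)]
              exact ENNReal.ofReal_le_ofReal (le_sqrt_pow_sub_sqrt_pow hj hω.1 hωt ht.2
                (habs.trans_le hvt.le) (habs.trans_le hvh.le))
            · rw [indicator_of_notMem (by exact hωt), add_zero]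
              refine ENNReal.ofReal_le_ofReal (pow_le_pow_left₀ (Real.sqrt_nonneg _) ?_ _)
              simpa using sqrt_one_sub_div_sq_le (v := v) hω.1 hω.2
        _ ≤ ENNReal.ofReal (√(1 - v ^ 2) ^ j) * ENNReal.ofReal (P 0) := by
            rw [lintegral_const]
            gcongr
            exact measure_univ_le_of_ae_eq_lintegral hP hs h
        _ = _ := by rw [← ENNReal.ofReal_mul hk0, mul_comm]
    have h2 : ENNReal.ofReal (P 0 * √(1 - v ^ 2) ^ j) ≤
        ENNReal.ofReal (P v * √(1 - v ^ 2) ^ j) + ENNReal.ofReal (η * v ^ 2) := by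
      rw [← ENNReal.ofReal_add (mul_nonneg (hP0 v) hk0) (by positivity)]
      refine ENNReal.ofReal_le_ofReal ?_
      have : (P 0 - P v) * √(1 - v ^ 2) ^ j ≤ η * v ^ 2 * √(1 - v ^ 2) ^ j := by gcongr
      have : η * v ^ 2 * √(1 - v ^ 2) ^ j ≤ η * v ^ 2 * 1 := by gcongr
      linarith
    have h3 := (ENNReal.add_le_add_iff_left ENNReal.ofReal_ne_top).1 (hle.trans h2)
    rw [ENNReal.ofReal_mul hδ0.le, ENNReal.ofReal_mul hη.le, mul_right_comm] at h3
    refine (ENNReal.mul_le_mul_iff_left ?_ ENNReal.ofReal_ne_top).1 h3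
    simpa using hv0.ne'
  have hzero : ENNReal.ofReal δ * ν {ω | s ω ≤ t} ≤ 0 := by
    refine ge_of_tendsto (x := 𝓝[>] (0 : ℝ)) (f := fun η => ENNReal.ofReal η) ?_
      (by filter_upwards [self_mem_nhdsWithin] with η hη using hmain η hη)
    have : Tendsto ENNReal.ofReal (𝓝 0) (𝓝 (ENNReal.ofReal 0)) := ENNReal.continuous_ofReal.tendsto 0
    rw [ENNReal.ofReal_zero] at this
    exact this.mono_left nhdsWithin_le_nhds
  simpa [hδ0.not_ge] using hzero

/-- If `P v * k v = ∫ k (v / s) dν` with `k v = (1 - v ^ 2) ^ (j / 2)` and `P` decreases near zero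
by less than every multiple of `v ^ 2`, then `s = 1` almost everywhere and `P` is constant. -/
theorem exists_ae_eq_const_of_ae_eq_lintegral (hj : 1 ≤ j) (hP : ContinuousAt P 0)
    (hP0 : ∀ v, 0 ≤ P v) (hs : Measurable s) (hs01 : ∀ᵐ ω ∂ν, s ω ∈ Ioc 0 1)
    (h : ∀ᵐ v ∂volume.restrict (Ioo (-1) 1), ENNReal.ofReal (P v * √(1 - v ^ 2) ^ j) =
      ∫⁻ ω, ENNReal.ofReal (√(1 - (v / s ω) ^ 2) ^ j) ∂ν)
    (hsmall : ∀ η > 0, ∀ᶠ v in 𝓝 0, P 0 - P v ≤ η * v ^ 2) :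
    ∃ C : ℝ, ∀ᵐ v ∂volume.restrict (Ioo (-1) 1), P v = C := by
  have hs1 : ∀ᵐ ω ∂ν, s ω = 1 := by
    -- Thresholds increasing to 1; the shift by 2 keeps the one for n = 0 positive.
    have : ∀ n : ℕ, ∀ᵐ ω ∂ν, 1 - 1 / ((n : ℝ) + 2) < s ω := fun n => by
      have h2 : (0 : ℝ) < 1 / ((n : ℝ) + 2) := by positivity
      have h3 : 1 / ((n : ℝ) + 2) < 1 := by
        rw [div_lt_one (by positivity)]; linarith [n.cast_nonneg (α := ℝ)]
      have := measure_le_eq_zero_of_ae_eq_lintegral hj hP hP0 hs hs01 h hsmall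
        (t := 1 - 1 / ((n : ℝ) + 2)) ⟨by linarith, by linarith⟩
      rw [ae_iff]
      simpa only [not_lt] using this
    filter_upwards [hs01, ae_all_iff.2 this] with ω hω hn
    refine le_antisymm hω.2 (le_of_forall_pos_lt_add fun ε hε => ?_)
    obtain ⟨n, hn'⟩ := exists_nat_one_div_lt hε
    have h4 : 1 / ((n : ℝ) + 2) ≤ 1 / (n + 1) := by gcongr; norm_num
    linarith [hn n]
  have hfin : ν univ ≠ ∞ :=
    ne_top_of_le_ne_top ENNReal.ofReal_ne_top (measure_univ_le_of_ae_eq_lintegral hP hs h)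
  refine ⟨(ν univ).toReal, ?_⟩
  filter_upwards [h, ae_restrict_mem measurableSet_Ioo] with v hv hvI
  have hk : 0 < √(1 - v ^ 2) ^ j :=
    pow_pos (Real.sqrt_pos.2 (by nlinarith [hvI.1, hvI.2])) j
  have h5 : ∫⁻ ω, ENNReal.ofReal (√(1 - (v / s ω) ^ 2) ^ j) ∂ν =
      ENNReal.ofReal (√(1 - v ^ 2) ^ j) * ν univ := by
    rw [← lintegral_const]
    refine lintegral_congr_ae ?_
    filter_upwards [hs1] with ω hω
    rw [hω, div_one]
  rw [h5, ENNReal.ofReal_mul (hP0 v), mul_comm] at hv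
  have h6 := (ENNReal.mul_right_inj (ENNReal.ofReal_pos.2 hk).ne' ENNReal.ofReal_ne_top).1 hv
  rw [← h6, ENNReal.toReal_ofReal (hP0 v)]

end

/-! ### From tested identities to an equation between densities. -/

theorem sqrt_one_sub_sq_pow_eq_zero {j : ℕ} (hj : 1 ≤ j) {u : ℝ} (hu : u ∉ Ioo (-1 : ℝ) 1) :
    √(1 - u ^ 2) ^ j = 0 := by
  rw [Real.sqrt_eq_zero_of_nonpos, zero_pow (by omega)]
  rw [sub_nonpos, one_le_sq_iff_one_le_abs]
  by_contra! h
  exact hu (abs_lt.1 h)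

/-- Substitution v = s u. `Real.sqrt` is zero on negatives and j ≥ 1, so both kernels vanish off
(-1, 1) and the integrals may be taken over ℝ. -/
theorem setLIntegral_comp_mul_sqrt_pow {j : ℕ} (hj : 1 ≤ j) {φ : ℝ → ℝ≥0∞} (hφ : Measurable φ)
    {s : ℝ} (hs : 0 < s) (hs1 : s ≤ 1) :
    ∫⁻ u in Ioo (-1) 1, ENNReal.ofReal (√(1 - u ^ 2) ^ j) * φ (s * u) =
      ∫⁻ v in Ioo (-1) 1,
        ENNReal.ofReal s⁻¹ * ENNReal.ofReal (√(1 - (v / s) ^ 2) ^ j) * φ v := by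
  have h1 := lintegral_comp_smul_addHaar (volume : Measure ℝ)
    (f := fun v => ENNReal.ofReal (√(1 - (v / s) ^ 2) ^ j) * φ v) (by fun_prop) hs
  simp only [smul_eq_mul, mul_div_cancel_left₀ _ hs.ne', Module.finrank_self, pow_one] at h1
  have hsub : ∀ v : ℝ, v ∉ Ioo (-1 : ℝ) 1 → v / s ∉ Ioo (-1 : ℝ) 1 := by
    intro v hv h
    have h2 := abs_lt.2 h
    rw [abs_div, abs_of_pos hs, div_lt_one hs] at h2
    exact hv (abs_lt.1 (h2.trans_le hs1))
  rw [setLIntegral_eq_of_support_subset, setLIntegral_eq_of_support_subset, h1,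
    ← lintegral_const_mul _ (by fun_prop)]
  · simp_rw [mul_assoc]
  · intro v hv
    by_contra h
    rw [Function.mem_support, sqrt_one_sub_sq_pow_eq_zero hj (hsub v h)] at hv
    simp at hv
  · intro v hv
    by_contra h
    rw [Function.mem_support, sqrt_one_sub_sq_pow_eq_zero hj h] at hv
    simp at hv

section

variable {Ω : Type*} [MeasurableSpace Ω] {μ : Measure Ω} [IsFiniteMeasure μ] {s : Ω → ℝ} {j : ℕ}

/-- Points with s = 0 contribute an atom at 0. They drop out of the first term because `0⁻¹ = 0`. -/
theorem lintegral_setLIntegral_comp_mul (hj : 1 ≤ j) (hs : Measurable s)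
    (hs01 : ∀ ω, s ω ∈ Icc 0 1) {φ : ℝ → ℝ≥0∞} (hφ : Measurable φ) :
    ∫⁻ ω, (∫⁻ u in Ioo (-1) 1, ENNReal.ofReal (√(1 - u ^ 2) ^ j) * φ (s ω * u)) ∂μ =
      (∫⁻ v in Ioo (-1) 1, (∫⁻ ω, ENNReal.ofReal (s ω)⁻¹ *
        ENNReal.ofReal (√(1 - (v / s ω) ^ 2) ^ j) ∂μ) * φ v) +
      (∫⁻ u in Ioo (-1) 1, ENNReal.ofReal (√(1 - u ^ 2) ^ j)) * μ {ω | s ω = 0} * φ 0 := by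
  have h0 : MeasurableSet {ω | s ω = 0} := measurableSet_eq_fun hs measurable_const
  have h1 : ∀ ω, ∫⁻ u in Ioo (-1) 1, ENNReal.ofReal (√(1 - u ^ 2) ^ j) * φ (s ω * u) =
      (∫⁻ v in Ioo (-1) 1, ENNReal.ofReal (s ω)⁻¹ *
        ENNReal.ofReal (√(1 - (v / s ω) ^ 2) ^ j) * φ v) +
      {ω | s ω = 0}.indicator
        (fun _ => (∫⁻ u in Ioo (-1) 1, ENNReal.ofReal (√(1 - u ^ 2) ^ j)) * φ 0) ω := by
    intro ω
    by_cases hω : s ω = 0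
    · rw [indicator_of_mem (by exact hω), hω]
      simp only [zero_mul, inv_zero, ENNReal.ofReal_zero, lintegral_zero, zero_add]
      rw [lintegral_mul_const _ (by fun_prop)]
    · rw [indicator_of_notMem (by exact hω), add_zero]
      exact setLIntegral_comp_mul_sqrt_pow hj hφ ((hs01 ω).1.lt_of_ne' hω) (hs01 ω).2
  simp_rw [h1]
  rw [lintegral_add_right _ (measurable_const.indicator h0), lintegral_indicator_const h0,
    lintegral_lintegral_swap (by fun_prop), mul_right_comm]
  congr 1
  refine lintegral_congr fun v => ?_
  rw [lintegral_mul_const _ (by fun_prop)]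

theorem ae_eq_lintegral_of_forall_lintegral_eq (hj : 1 ≤ j) (hs : Measurable s)
    (hs01 : ∀ ω, s ω ∈ Icc 0 1) {p : ℝ → ℝ≥0∞} (hp : Measurable p)
    (hpfin : ∫⁻ v in Ioo (-1) 1, p v ≠ ∞)
    (h : ∀ φ : ℝ →ᵇ ℝ≥0, ∫⁻ v in Ioo (-1) 1, p v * φ v =
      ∫⁻ ω, (∫⁻ u in Ioo (-1) 1, ENNReal.ofReal (√(1 - u ^ 2) ^ j) * φ (s ω * u)) ∂μ) :
    ∀ᵐ v ∂volume.restrict (Ioo (-1) 1), p v = ∫⁻ ω, ENNReal.ofReal (√(1 - (v / s ω) ^ 2) ^ j)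
      ∂μ.withDensity (fun ω => ENNReal.ofReal (s ω)⁻¹) := by
  set H : ℝ → ℝ≥0∞ := fun v => ∫⁻ ω, ENNReal.ofReal (s ω)⁻¹ *
    ENNReal.ofReal (√(1 - (v / s ω) ^ 2) ^ j) ∂μ with hH
  have hHm : Measurable H := Measurable.lintegral_prod_right (by fun_prop)
  set c : ℝ≥0∞ := (∫⁻ u in Ioo (-1) 1, ENNReal.ofReal (√(1 - u ^ 2) ^ j)) * μ {ω | s ω = 0}
  have : IsFiniteMeasure ((volume.restrict (Ioo (-1 : ℝ) 1)).withDensity p) :=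
    isFiniteMeasure_withDensity hpfin
  have hM : (volume.restrict (Ioo (-1 : ℝ) 1)).withDensity p =
      (volume.restrict (Ioo (-1 : ℝ) 1)).withDensity H + c • Measure.dirac 0 := by
    refine ext_of_forall_lintegral_eq_of_IsFiniteMeasure fun φ => ?_
    have hφ : Measurable fun v => (φ v : ℝ≥0∞) := by fun_prop
    rw [lintegral_add_measure, lintegral_smul_measure, lintegral_dirac,
      lintegral_withDensity_eq_lintegral_mul _ hp hφ,
      lintegral_withDensity_eq_lintegral_mul _ hHm hφ]
    exact (h φ).trans (lintegral_setLIntegral_comp_mul hj hs hs01 hφ)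
  -- Both densities give {0} mass zero, so the atom must vanish.
  have hc : c = 0 := by
    have h1 := congrArg (fun M : Measure ℝ => M {0}) hM
    simp only [Measure.add_apply, Measure.smul_apply, measure_singleton, smul_eq_mul] at h1
    simpa using h1.symm
  rw [hc, zero_smul, add_zero, withDensity_eq_iff hp.aemeasurable hHm.aemeasurable hpfin] at hM
  filter_upwards [hM] with v hv
  rw [hv, lintegral_withDensity_eq_lintegral_mul _ (by fun_prop) (by fun_prop)]
  rfl

/-- The ratio `C₂ / C₁` is absorbed into μ. -/
theorem exists_ae_eq_const_of_forall_lintegral_eq (hj : 1 ≤ j) (hs : Measurable s)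
    (hs01 : ∀ ω, s ω ∈ Icc 0 1) {P : ℝ → ℝ} (hPm : Measurable P) (hP : ContinuousAt P 0)
    (hP0 : ∀ v, 0 ≤ P v) (hsmall : ∀ η > 0, ∀ᶠ v in 𝓝 0, P 0 - P v ≤ η * v ^ 2)
    {C₁ C₂ : ℝ≥0∞} (hC₁ : C₁ ≠ 0) (hC₁' : C₁ ≠ ∞) (hC₂' : C₂ ≠ ∞)
    (h : ∀ φ : ℝ →ᵇ ℝ≥0,
      C₁ * ∫⁻ v in Ioo (-1) 1, ENNReal.ofReal (P v * √(1 - v ^ 2) ^ j) * φ v =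
      ∫⁻ ω, (C₂ * ∫⁻ u in Ioo (-1) 1, ENNReal.ofReal (√(1 - u ^ 2) ^ j) * φ (s ω * u)) ∂μ) :
    ∃ C : ℝ, ∀ᵐ v ∂volume.restrict (Ioo (-1) 1), P v = C := by
  have hc : C₂ / C₁ ≠ ∞ := ENNReal.div_ne_top hC₂' hC₁
  lift C₂ / C₁ to ℝ≥0 using hc with c hcc
  have hj' : ∫⁻ u in Ioo (-1 : ℝ) 1, ENNReal.ofReal (√(1 - u ^ 2) ^ j) ≤ 2 := by
    calc _ ≤ ∫⁻ _ in Ioo (-1 : ℝ) 1, 1 := by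
          refine lintegral_mono fun u => ?_
          rw [← ENNReal.ofReal_one]
          exact ENNReal.ofReal_le_ofReal (pow_le_one₀ (Real.sqrt_nonneg _)
            (Real.sqrt_le_one.2 (by nlinarith [sq_nonneg u])))
      _ = 2 := by norm_num
  have h' : ∀ φ : ℝ →ᵇ ℝ≥0,
      ∫⁻ v in Ioo (-1) 1, ENNReal.ofReal (P v * √(1 - v ^ 2) ^ j) * φ v =
      ∫⁻ ω, (∫⁻ u in Ioo (-1) 1, ENNReal.ofReal (√(1 - u ^ 2) ^ j) * φ (s ω * u)) ∂(c • μ) := by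
    intro φ
    have hφ : Measurable fun v => (φ v : ℝ≥0∞) := by fun_prop
    have hm : Measurable fun ω => ∫⁻ u in Ioo (-1) 1,
        ENNReal.ofReal (√(1 - u ^ 2) ^ j) * φ (s ω * u) :=
      Measurable.lintegral_prod_right (by fun_prop)
    have h1 := h φ
    rw [lintegral_const_mul _ hm] at h1
    rw [lintegral_smul_measure, ENNReal.smul_def, smul_eq_mul, hcc, div_eq_mul_inv, mul_right_comm,
      ← h1, mul_comm, ← mul_assoc, ENNReal.inv_mul_cancel hC₁ hC₁', one_mul]
  have hpfin : ∫⁻ v in Ioo (-1) 1, ENNReal.ofReal (P v * √(1 - v ^ 2) ^ j) ≠ ∞ := by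
    have h1 := h' 1
    simp only [BoundedContinuousFunction.coe_one, Pi.one_apply, ENNReal.coe_one, mul_one,
      lintegral_const] at h1
    rw [h1]
    exact ENNReal.mul_ne_top (ne_top_of_le_ne_top (by norm_num) hj') (measure_ne_top _ _)
  have hae := ae_eq_lintegral_of_forall_lintegral_eq hj hs hs01 (by fun_prop) hpfin h'
  refine exists_ae_eq_const_of_ae_eq_lintegral hj hP hP0 hs ?_ hae hsmall
  -- The weight `(s ω)⁻¹` is zero where s = 0, so only positive s remain.
  rw [ae_withDensity_iff (by fun_prop)]
  refine Eventually.of_forall fun ω hω => ⟨(hs01 ω).1.lt_of_ne ?_, (hs01 ω).2⟩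
  rintro h0
  simp [← h0] at hω

end

/-! ### Spherical Radon transform of zonal functions. -/

theorem exists_norm_eq_one_smul {V : Type*} [NormedAddCommGroup V] [NormedSpace ℝ V]
    [Nontrivial V] (p : V) : ∃ e : V, ‖e‖ = 1 ∧ p = ‖p‖ • e := by
  by_cases hp : p = 0
  · obtain ⟨e, he⟩ := exists_norm_eq V zero_le_one
    exact ⟨e, he, by simp [hp]⟩
  · exact ⟨‖p‖⁻¹ • p, norm_smul_inv_norm hp, by rw [smul_inv_smul₀ (norm_ne_zero_iff.2 hp)]⟩

section

variable {n : ℕ} [NeZero n]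

/-- The vector p is the orthogonal projection of the axis vector to ξ^⊥. It vanishes when ξ is a
pole, which is why `exists_norm_eq_one_smul` admits p = 0. -/
theorem exists_orthogonal_inner_eq (ξ : sphere (0 : EuclideanSpace ℝ (Fin n)) 1) :
    ∃ p : (Submodule.span ℝ {(ξ : EuclideanSpace ℝ (Fin n))})ᗮ,
      ‖p‖ = √(1 - (ξ : EuclideanSpace ℝ (Fin n)) 0 ^ 2) ∧
      ∀ θ : (Submodule.span ℝ {(ξ : EuclideanSpace ℝ (Fin n))})ᗮ,
        inner ℝ p θ = (θ : EuclideanSpace ℝ (Fin n)) 0 := by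
  set x : EuclideanSpace ℝ (Fin n) := (ξ : EuclideanSpace ℝ (Fin n)) with hx
  have hx1 : ‖x‖ = 1 := norm_eq_of_mem_sphere ξ
  set e : EuclideanSpace ℝ (Fin n) := EuclideanSpace.single 0 1 with he
  have hex : inner ℝ x e = x 0 := by simp [he, EuclideanSpace.inner_single_right]
  refine ⟨⟨e - x 0 • x, ?_⟩, ?_, fun θ => ?_⟩
  · rw [Submodule.mem_orthogonal_singleton_iff_inner_right, inner_sub_right, inner_smul_right,
      real_inner_self_eq_norm_sq, hx1, hex]
    ring
  · rw [Submodule.coe_norm, ← Real.sqrt_sq (norm_nonneg _), norm_sub_sq_real, inner_smul_right,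
      real_inner_comm, hex, norm_smul, hx1, he]
    congr 1
    simp
    ring
  · have h := (Submodule.mem_orthogonal_singleton_iff_inner_right).1 θ.2
    rw [Submodule.coe_inner, inner_sub_left, inner_smul_left, h, he]
    simp [EuclideanSpace.inner_single_left]

theorem sphericalRadon_zonal {m : ℕ} (hn : n = m + 4)
    (φ : ℝ →ᵇ ℝ≥0) (ξ : sphere (0 : EuclideanSpace ℝ (Fin n)) 1) :
    sphericalRadon (fun θ => (φ ((θ : EuclideanSpace ℝ (Fin n)) 0) : ℝ)) ξ =
      (zonalConst m * ∫⁻ u in Ioo (-1) 1, ENNReal.ofReal (√(1 - u ^ 2) ^ m) *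
        φ (√(1 - (ξ : EuclideanSpace ℝ (Fin n)) 0 ^ 2) * u)).toReal := by
  have hV : Module.finrank ℝ (Submodule.span ℝ {(ξ : EuclideanSpace ℝ (Fin n))})ᗮ = m + 3 := by
    have hξ : (ξ : EuclideanSpace ℝ (Fin n)) ≠ 0 := ne_zero_of_mem_unit_sphere ξ
    have : Fact (Module.finrank ℝ (EuclideanSpace ℝ (Fin n)) = m + 3 + 1) := ⟨by simp [hn]⟩
    exact Submodule.finrank_orthogonal_span_singleton hξ
  have : Nontrivial (Submodule.span ℝ {(ξ : EuclideanSpace ℝ (Fin n))})ᗮ :=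
    Module.nontrivial_of_finrank_pos (R := ℝ) (by omega)
  obtain ⟨p, hp, hpθ⟩ := exists_orthogonal_inner_eq ξ
  obtain ⟨e, he, hpe⟩ := exists_norm_eq_one_smul p
  have h1 : ∀ θ : sphere (0 : (Submodule.span ℝ {(ξ : EuclideanSpace ℝ (Fin n))})ᗮ) 1,
      (subsphereInclusion ξ θ : EuclideanSpace ℝ (Fin n)) 0 =
        √(1 - (ξ : EuclideanSpace ℝ (Fin n)) 0 ^ 2) * inner ℝ e
          (θ : (Submodule.span ℝ {(ξ : EuclideanSpace ℝ (Fin n))})ᗮ) := fun θ => by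
    change ((θ : (Submodule.span ℝ {(ξ : EuclideanSpace ℝ (Fin n))})ᗮ) :
      EuclideanSpace ℝ (Fin n)) 0 = _
    rw [← hpθ, hpe, inner_smul_left, hp]
    rfl
  rw [sphericalRadon, ← lintegral_surfaceMeasure_inner hV he (F := fun u =>
    φ (√(1 - (ξ : EuclideanSpace ℝ (Fin n)) 0 ^ 2) * u)) (by fun_prop)]
  simp_rw [h1]
  rw [integral_eq_lintegral_of_nonneg_ae (Eventually.of_forall fun θ => NNReal.coe_nonneg _)
    (by fun_prop)]
  simp_rw [ENNReal.ofReal_coe_nnreal]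

end

/-! ### Second-order behaviour at the equator. -/

/-- Taylor's formula leaves only a linear term, which averaging over x and -x removes. -/
theorem isLittleO_sub_of_even {G : ℝ → ℝ} (hG : ContDiffOn ℝ 2 G (Ioo (-1) 1))
    (hG2 : iteratedDeriv 2 G 0 = 0) (heven : ∀ x ∈ Ioo (-1 : ℝ) 1, G (-x) = G x) :
    (fun x => G x - G 0) =o[𝓝 0] fun x => x ^ 2 := by
  have h0 : (0 : ℝ) ∈ Ioo (-1 : ℝ) 1 := by norm_num
  have hnhds : Ioo (-1 : ℝ) 1 ∈ 𝓝 (0 : ℝ) := isOpen_Ioo.mem_nhds h0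
  have h1 := taylor_isLittleO (n := 2) (convex_Ioo (-1 : ℝ) 1) h0 (by exact_mod_cast hG)
  rw [nhdsWithin_eq_nhds.2 hnhds] at h1
  have h2 : iteratedDerivWithin 2 G (Ioo (-1) 1) 0 = 0 := by
    rw [iteratedDerivWithin_of_isOpen isOpen_Ioo h0, hG2]
  simp only [taylorWithinEval_succ, taylor_within_zero_eval, h2, sub_zero] at h1
  set c := iteratedDerivWithin (0 + 1) G (Ioo (-1) 1) 0
  have h3 : (fun x => G x - G 0 - c * x) =o[𝓝 0] fun x => x ^ 2 := by
    refine h1.congr_left fun x => ?_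
    simp
    ring
  have h4 : (fun x => G (-x) - G 0 + c * x) =o[𝓝 0] fun x => x ^ 2 := by
    have hneg : Tendsto (fun x : ℝ => -x) (𝓝 0) (𝓝 0) := by
      simpa using (continuous_neg (G := ℝ)).tendsto 0
    have := h3.comp_tendsto hneg
    refine this.congr (fun x => ?_) (fun x => ?_)
    · simp
    · simp
  have h5 := (h3.add h4).const_mul_left (1 / 2)
  refine h5.congr' ?_ EventuallyEq.rfl
  filter_upwards [hnhds] with x hx
  rw [heven x hx]
  ring

theorem eventually_inv_sub_inv_comp_le {G : ℝ → ℝ} (h0 : 0 < G 0)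
    (hG : (fun x => G x - G 0) =o[𝓝 0] fun x => x ^ 2) {η : ℝ} (hη : 0 < η) :
    ∀ᶠ v in 𝓝 (0 : ℝ), (G 0)⁻¹ - (G (v / √(1 - v ^ 2)))⁻¹ ≤ η * v ^ 2 := by
  have hw : Tendsto (fun v : ℝ => v / √(1 - v ^ 2)) (𝓝 0) (𝓝 0) := by
    have : ContinuousAt (fun v : ℝ => v / √(1 - v ^ 2)) 0 := by
      refine ContinuousAt.div (by fun_prop) (by fun_prop) (by simp)
    simpa using this.tendsto
  -- The constant is chosen to absorb w² ≤ 2v² and G(w) > G(0)/2 in 1/G(0) - 1/G(w) = (G(w) -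
  -- G(0))/(G(0)G(w)).
  have h1 := hw.eventually (hG.def (show (0 : ℝ) < η * G 0 ^ 2 / 4 by positivity))
  have hlim : Tendsto G (𝓝 0) (𝓝 (G 0)) := by
    have h2 := hG.trans_tendsto (by
      simpa using (continuous_pow 2 (M := ℝ)).tendsto 0 : Tendsto (fun x : ℝ => x ^ 2) (𝓝 0) (𝓝 0))
    simpa using h2.add_const (G 0)
  have h2 := hw.eventually (hlim.eventually_const_lt (half_lt_self h0))
  have h3 : ∀ᶠ v in 𝓝 (0 : ℝ), v ∈ Ioo (-(1 / 2) : ℝ) (1 / 2) :=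
    isOpen_Ioo.mem_nhds (by norm_num)
  filter_upwards [h1, h2, h3] with v hv1 hv2 hv3
  set w := v / √(1 - v ^ 2) with hwdef
  have hvsq : v ^ 2 ≤ 1 / 4 := by nlinarith [hv3.1, hv3.2]
  have hw2 : w ^ 2 ≤ 2 * v ^ 2 := by
    rw [hwdef, div_pow, Real.sq_sqrt (by linarith), div_le_iff₀ (by linarith)]
    nlinarith [sq_nonneg v]
  rw [Real.norm_eq_abs, Real.norm_of_nonneg (sq_nonneg w)] at hv1
  have hGw : 0 < G w := by linarith
  rw [inv_sub_inv h0.ne' hGw.ne', div_le_iff₀ (by positivity)]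
  calc G w - G 0 ≤ η * G 0 ^ 2 / 4 * w ^ 2 := (le_abs_self _).trans hv1
    _ ≤ η * G 0 ^ 2 / 4 * (2 * v ^ 2) := by gcongr
    _ = η * v ^ 2 * (G 0 * (G 0 / 2)) := by ring
    _ ≤ η * v ^ 2 * (G 0 * G w) := by gcongr

/-! ### Gauge and radial function of the body. -/

theorem IsSymmConvexBody.gauge_pos {n : ℕ} {K : Set (EuclideanSpace ℝ (Fin n))}
    (hK : IsSymmConvexBody K) (h0 : K ∈ 𝓝 0) {z : EuclideanSpace ℝ (Fin n)} (hz : z ≠ 0) :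
    0 < gauge K z :=
  (_root_.gauge_pos (absorbent_nhds_zero h0)
    (NormedSpace.isVonNBounded_of_isBounded ℝ hK.isCompact.isBounded)).2 hz

theorem IsSymmConvexBody.inv_gauge_smul_mem {n : ℕ} {K : Set (EuclideanSpace ℝ (Fin n))}
    (hK : IsSymmConvexBody K) (h0 : K ∈ 𝓝 0) {z : EuclideanSpace ℝ (Fin n)} (hz : z ≠ 0) :
    (gauge K z)⁻¹ • z ∈ K := by
  have hpos := hK.gauge_pos h0 hz
  have h : (gauge K z)⁻¹ • z ∈ closure K := by
    rw [← gauge_le_one_iff_mem_closure hK.convex h0,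
      gauge_smul_of_nonneg (inv_nonneg.2 hpos.le), smul_eq_mul, inv_mul_cancel₀ hpos.ne']
  rwa [hK.isCompact.isClosed.closure_eq] at h

theorem radialFunction_eq_inv_gauge {n : ℕ} {K : Set (EuclideanSpace ℝ (Fin n))}
    (hK : IsSymmConvexBody K) (h0 : K ∈ 𝓝 0)
    (ξ : sphere (0 : EuclideanSpace ℝ (Fin n)) 1) :
    radialFunction K ξ = (gauge K (ξ : EuclideanSpace ℝ (Fin n)))⁻¹ := by
  have hpos : 0 < gauge K (ξ : EuclideanSpace ℝ (Fin n)) :=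
    hK.gauge_pos h0 (ne_zero_of_mem_unit_sphere ξ)
  refine IsGreatest.csSup_eq ⟨?_, ?_⟩
  · exact hK.inv_gauge_smul_mem h0 (ne_zero_of_mem_unit_sphere ξ)
  · intro a ha
    rcases le_or_gt a 0 with h | h
    · exact h.trans (inv_nonneg.2 hpos.le)
    · have := gauge_le_one_of_mem (show a • (ξ : EuclideanSpace ℝ (Fin n)) ∈ K from ha)
      rw [gauge_smul_of_nonneg h.le, smul_eq_mul] at this
      rwa [← one_div, le_div_iff₀ hpos]

section

variable {d : ℕ} {K : Set (EuclideanSpace ℝ (Fin (d + 1)))}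

theorem yPart_smul (c : ℝ) (z : EuclideanSpace ℝ (Fin (d + 1))) : yPart (c • z) = c • yPart z := by
  ext i; simp [yPart]

theorem yPart_neg (z : EuclideanSpace ℝ (Fin (d + 1))) : yPart (-z) = -yPart z := by
  ext i; simp [yPart]

theorem abs_apply_zero_le_gauge (hK : IsSymmConvexBody K) (h0 : K ∈ 𝓝 0) (hface : HasUnitFace K)
    (z : EuclideanSpace ℝ (Fin (d + 1))) : |z 0| ≤ gauge K z := by
  rcases eq_or_ne z 0 with rfl | hz
  · simp
  have hpos := hK.gauge_pos h0 hz
  have hmem := hK.inv_gauge_smul_mem h0 hz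
  have h1 := hface.1 _ hmem
  have h2 := hface.1 _ (hK.symm _ hmem)
  simp only [PiLp.neg_apply, PiLp.smul_apply, smul_eq_mul, ← mul_neg] at h1 h2
  rw [inv_mul_le_iff₀ hpos, mul_one] at h1 h2
  exact abs_le.2 ⟨by linarith, h1⟩

/-- For x ≠ 0 the point z/x lies in the face, hence in K; the reverse inequality holds because K
lies in the slab |x| ≤ 1. -/
theorem gauge_eq_abs_apply_zero (hK : IsSymmConvexBody K) (h0 : K ∈ 𝓝 0) (hface : HasUnitFace K)
    {z : EuclideanSpace ℝ (Fin (d + 1))} (hz : ‖yPart z‖ ≤ |z 0|) : gauge K z = |z 0| := by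
  refine le_antisymm ?_ (abs_apply_zero_le_gauge hK h0 hface z)
  rcases eq_or_ne (z 0) 0 with h | h
  · have hn := norm_eq_sqrt_yPart z
    rw [h, abs_zero] at hz
    rw [h, le_antisymm hz (norm_nonneg _)] at hn
    have : z = 0 := norm_eq_zero.1 (by simpa using hn)
    simp [this]
  have hmem : (z 0)⁻¹ • z ∈ {z | z ∈ K ∧ z 0 = 1} := by
    rw [hface.2]
    refine ⟨by simp [h], ?_⟩
    rw [yPart_smul, norm_smul, norm_inv, Real.norm_eq_abs, inv_mul_le_iff₀ (abs_pos.2 h), mul_one]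
    exact hz
  have h1 := gauge_le_one_of_mem hmem.1
  have h2 : gauge K (|z 0| • (z 0)⁻¹ • z) = gauge K z := by
    rcases abs_choice (z 0) with h3 | h3
    · rw [h3, smul_inv_smul₀ h]
    · rw [h3, neg_smul, smul_inv_smul₀ h, gauge_neg hK.symm]
  rw [← h2, gauge_smul_of_nonneg (abs_nonneg _), smul_eq_mul]
  exact mul_le_of_le_one_right (abs_nonneg _) h1

theorem gauge_congr_of_norm_yPart_eq (hK : IsSymmConvexBody K) (h0 : K ∈ 𝓝 0)
    (hface : HasUnitFace K) {g : ℝ → ℝ → ℝ}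
    (hg : ∀ (z : EuclideanSpace ℝ (Fin (d + 1))) (r : ℝ),
      |r| = ‖yPart z‖ → |z 0| < |r| → gauge K z = g (z 0) r)
    {z w : EuclideanSpace ℝ (Fin (d + 1))} (hzw : z 0 = w 0) (hy : ‖yPart z‖ = ‖yPart w‖) :
    gauge K z = gauge K w := by
  by_cases h : ‖yPart z‖ ≤ |z 0|
  · rw [gauge_eq_abs_apply_zero hK h0 hface h, gauge_eq_abs_apply_zero hK h0 hface
      (by rwa [← hy, ← hzw]), hzw]
  · push Not at h
    rw [hg z ‖yPart z‖ (abs_norm _) (by rwa [abs_norm]),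
      hg w ‖yPart z‖ ((abs_norm _).trans hy) (by rwa [abs_norm, ← hzw]), hzw]

end

/-- The point `(x, r, 0, …, 0)`. -/
noncomputable def planePoint (j : ℕ) (x r : ℝ) : EuclideanSpace ℝ (Fin (j + 4)) :=
  x • EuclideanSpace.single 0 1 + r • EuclideanSpace.single 1 1

section

variable {j : ℕ}

@[simp] theorem planePoint_apply_zero (x r : ℝ) : planePoint j x r 0 = x := by
  simp [planePoint]

@[simp] theorem norm_yPart_planePoint (x r : ℝ) : ‖yPart (d := j + 3) (planePoint j x r)‖ = |r| := by
  have : yPart (d := j + 3) (planePoint j x r) = r • EuclideanSpace.single 0 1 := by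
    ext i
    by_cases hi : i = 0
    · subst hi; simp [yPart, planePoint]
    · have : i.succ ≠ 1 := fun h => hi (Fin.succ_injective _ h)
      simp [yPart, planePoint, hi, this]
  rw [this, norm_smul]
  simp

theorem planePoint_ne_zero {x r : ℝ} (h : x ≠ 0 ∨ r ≠ 0) : planePoint j x r ≠ 0 := by
  intro h0
  rcases h with h | h
  · exact h (by rw [← planePoint_apply_zero (j := j) x r, h0]; rfl)
  · have := norm_yPart_planePoint (j := j) x r
    rw [h0] at this
    exact h (abs_eq_zero.1 (by rw [← this]; simp [yPart, EuclideanSpace.norm_eq]))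

theorem smul_planePoint (c x r : ℝ) : c • planePoint j x r = planePoint j (c * x) (c * r) := by
  simp [planePoint, smul_smul]

end

/-! ### The identity for zonal test functions and the contradiction. -/

theorem lintegral_zonal_eq_lintegral_radon {j : ℕ}
    {μ : Measure (sphere (0 : EuclideanSpace ℝ (Fin (j + 4))) 1)} [IsFiniteMeasure μ]
    {ρ : sphere (0 : EuclideanSpace ℝ (Fin (j + 4))) 1 → ℝ} (hρ : Continuous ρ)
    (hρ0 : ∀ ξ, 0 ≤ ρ ξ)
    (h : ∀ g : C(sphere (0 : EuclideanSpace ℝ (Fin (j + 4))) 1, ℝ),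
        ∫ ξ, ρ ξ * g ξ ∂(surfaceMeasure (EuclideanSpace ℝ (Fin (j + 4)))) =
          ∫ ξ, sphericalRadon g ξ ∂μ) (φ : ℝ →ᵇ ℝ≥0) :
    ∫⁻ ξ, ENNReal.ofReal (ρ ξ) * φ ((ξ : EuclideanSpace ℝ (Fin (j + 4))) 0)
        ∂(surfaceMeasure (EuclideanSpace ℝ (Fin (j + 4)))) =
      ∫⁻ ξ, (zonalConst j * ∫⁻ u in Ioo (-1) 1, ENNReal.ofReal (√(1 - u ^ 2) ^ j) *
        φ (√(1 - (ξ : EuclideanSpace ℝ (Fin (j + 4))) 0 ^ 2) * u)) ∂μ := by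
  have : IsFiniteMeasure (surfaceMeasure (EuclideanSpace ℝ (Fin (j + 4)))) := by
    unfold surfaceMeasure; infer_instance
  set G : C(sphere (0 : EuclideanSpace ℝ (Fin (j + 4))) 1, ℝ) :=
    ⟨fun θ => (φ ((θ : EuclideanSpace ℝ (Fin (j + 4))) 0) : ℝ), by fun_prop⟩ with hG
  have hφ : Measurable fun v => (φ v : ℝ≥0∞) := by fun_prop
  set A : sphere (0 : EuclideanSpace ℝ (Fin (j + 4))) 1 → ℝ≥0∞ := fun ξ =>
    zonalConst j * ∫⁻ u in Ioo (-1) 1, ENNReal.ofReal (√(1 - u ^ 2) ^ j) *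
        φ (√(1 - (ξ : EuclideanSpace ℝ (Fin (j + 4))) 0 ^ 2) * u) with hA
  have hAm : Measurable A :=
    (Measurable.lintegral_prod_right (by fun_prop)).const_mul _
  -- A uniform bound, sup φ times the length 2 of (-1, 1), justifies passing between Bochner and
  -- Lebesgue integrals.
  have hAle : ∀ ξ, A ξ ≤ zonalConst j * (nndist φ 0 * 2) := fun ξ => by
    refine mul_le_mul_right ?_ _
    calc _ ≤ ∫⁻ _ in Ioo (-1 : ℝ) 1, (nndist φ 0 : ℝ≥0∞) := by
          refine lintegral_mono fun u => ?_
          rw [← one_mul (nndist φ 0 : ℝ≥0∞)]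
          gcongr
          · exact ENNReal.ofReal_le_one.2 (pow_le_one₀ (Real.sqrt_nonneg _)
              (Real.sqrt_le_one.2 (by nlinarith [sq_nonneg u])))
          · exact BoundedContinuousFunction.NNReal.upper_bound φ _
      _ = nndist φ 0 * 2 := by rw [setLIntegral_const, Real.volume_Ioo]; norm_num
  have hbd : zonalConst j * (nndist φ 0 * 2) < ∞ :=
    ENNReal.mul_lt_top (zonalConst_ne_top j).lt_top
      (ENNReal.mul_lt_top ENNReal.coe_lt_top (by norm_num))
  have hAfin : ∫⁻ ξ, A ξ ∂μ ≠ ∞ :=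
    ne_top_of_le_ne_top (by
      rw [lintegral_const]
      exact ENNReal.mul_ne_top hbd.ne (measure_ne_top _ _)) (lintegral_mono hAle)
  have h1 : ENNReal.ofReal (∫ ξ, sphericalRadon G ξ ∂μ) = ∫⁻ ξ, A ξ ∂μ := by
    have h2 : ∀ ξ, sphericalRadon G ξ = (A ξ).toReal := fun ξ => sphericalRadon_zonal rfl φ ξ
    simp_rw [h2]
    rw [integral_toReal hAm.aemeasurable (Eventually.of_forall fun ξ => (hAle ξ).trans_lt hbd),
      ENNReal.ofReal_toReal hAfin]
  rw [← h1, ← h G, ofReal_integral_eq_lintegral_ofReal]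
  · refine lintegral_congr fun ξ => ?_
    rw [ENNReal.ofReal_mul (hρ0 ξ)]
    congr 1
    exact ENNReal.ofReal_coe_nnreal.symm
  · exact (BoundedContinuousFunction.mkOfCompact ⟨fun ξ => ρ ξ * G ξ, by fun_prop⟩).integrable _
  · exact Eventually.of_forall fun ξ => mul_nonneg (hρ0 ξ) (NNReal.coe_nonneg _)

theorem radialFunction_eq_inv_gauge_planePoint {j : ℕ} {K : Set (EuclideanSpace ℝ (Fin (j + 4)))}
    (hK : IsSymmConvexBody K) (h0 : K ∈ 𝓝 0) (hface : HasUnitFace (d := j + 3) K) {g : ℝ → ℝ → ℝ}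
    (hg : ∀ (z : EuclideanSpace ℝ (Fin (j + 3 + 1))) (r : ℝ),
      |r| = ‖yPart z‖ → |z 0| < |r| → gauge K z = g (z 0) r)
    (ξ : sphere (0 : EuclideanSpace ℝ (Fin (j + 4))) 1) :
    radialFunction K ξ = (gauge K (planePoint j ((ξ : EuclideanSpace ℝ (Fin (j + 4))) 0)
      √(1 - (ξ : EuclideanSpace ℝ (Fin (j + 4))) 0 ^ 2)))⁻¹ := by
  rw [radialFunction_eq_inv_gauge hK h0,
    gauge_congr_of_norm_yPart_eq (d := j + 3) hK h0 hface hg (planePoint_apply_zero _ _).symm ?_]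
  have h1 := norm_sq_eq_sq_add_yPart (d := j + 3) (ξ : EuclideanSpace ℝ (Fin (j + 4)))
  rw [norm_eq_of_mem_sphere, one_pow] at h1
  have h2 : 1 - (ξ : EuclideanSpace ℝ (Fin (j + 4))) 0 ^ 2 =
      ‖yPart (d := j + 3) (ξ : EuclideanSpace ℝ (Fin (j + 4)))‖ ^ 2 := by linarith
  rw [norm_yPart_planePoint, abs_of_nonneg (Real.sqrt_nonneg _), h2,
    Real.sqrt_sq (norm_nonneg _)]

theorem mainTheorem2 (d : ℕ) (hd : 5 ≤ d + 1)
    (K : Set (EuclideanSpace ℝ (Fin (d + 1)))) (hK : IsSymmConvexBody K)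
    (hrev : IsOfRevolution K) (hface : HasUnitFace K)
    (g : ℝ → ℝ → ℝ)
    (hg : ∀ (z : EuclideanSpace ℝ (Fin (d + 1))) (r : ℝ),
      |r| = ‖yPart z‖ → |z 0| < |r| → gauge K z = g (z 0) r)
    (hC2 : ∀ r : ℝ, r ≠ 0 →
      ContDiffOn ℝ 2 (fun x => g x r) (Set.Ioo (-|r|) |r|) ∧
        iteratedDeriv 2 (fun x => g x r) 0 = 0)
    (hunif : ∀ r₀ : ℝ, 0 < r₀ →
      TendstoUniformlyOn (fun x r => iteratedDeriv 2 (fun t => g t r) x) (fun _ => 0)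
        (𝓝[≠] (0 : ℝ)) {r : ℝ | r₀ ≤ |r|}) :
    ¬ IsIntersectionBody K := by
  obtain ⟨j, rfl⟩ : ∃ j, d = j + 3 := ⟨d - 3, by omega⟩
  have hj : 1 ≤ j := by omega
  rintro ⟨hstar, μ, hμ, -, hint⟩
  have h0 : K ∈ 𝓝 0 := mem_interior_iff_mem_nhds.1 hstar.zero_mem_interior
  -- For |u| > 1 the root is 0 and the point is (u, 0) ≠ 0, so q is continuous and positive on all
  -- of ℝ.
  set q : ℝ → ℝ := fun u => gauge K (planePoint j u √(1 - u ^ 2)) with hq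
  have hqc : Continuous q := by
    refine (continuous_gauge hK.convex h0).comp ?_
    unfold planePoint
    fun_prop
  have hqpos : ∀ u, 0 < q u := fun u => hK.gauge_pos h0 (planePoint_ne_zero (by
    by_cases hu : u = 0
    · right; simp [hu]
    · exact Or.inl hu))
  -- One factor √(1 - u²) of the density on the big sphere goes into P, so that the remaining power
  -- j matches the great subspheres.
  set P : ℝ → ℝ := fun u => √(1 - u ^ 2) * (q u)⁻¹ with hPdef
  have hPc : Continuous P := by
    have : Continuous fun u => (q u)⁻¹ := hqc.inv₀ fun u => (hqpos u).ne'
    fun_prop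
  have hPnonneg : ∀ u, 0 ≤ P u := fun u =>
    mul_nonneg (Real.sqrt_nonneg _) (inv_nonneg.2 (hqpos u).le)
  set G : ℝ → ℝ := fun x => g x 1 with hGdef
  have hG : ∀ x ∈ Ioo (-1 : ℝ) 1, gauge K (planePoint j x 1) = G x := fun x hx => by
    have := hg (planePoint j x 1) 1 (norm_yPart_planePoint x 1).symm (by
      rw [abs_one]; exact (planePoint_apply_zero (j := j) x 1).symm ▸ abs_lt.2 hx)
    rw [this]
    exact congrArg (g · 1) (planePoint_apply_zero x 1)
  have hGeven : ∀ x ∈ Ioo (-1 : ℝ) 1, G (-x) = G x := fun x hx => by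
    rw [← hG x hx, ← hG (-x) ⟨by linarith [hx.2], by linarith [hx.1]⟩, ← gauge_neg hK.symm]
    refine gauge_congr_of_norm_yPart_eq hK h0 hface hg ?_ ?_
    · simp
    · rw [yPart_neg, norm_neg, norm_yPart_planePoint, norm_yPart_planePoint]
  have hGo : (fun x => G x - G 0) =o[𝓝 0] fun x => x ^ 2 := by
    obtain ⟨hc, hd2⟩ := hC2 1 one_ne_zero
    rw [abs_one] at hc
    exact isLittleO_sub_of_even hc hd2 hGeven
  have hG0 : 0 < G 0 := by
    rw [← hG 0 (by norm_num)]
    exact hK.gauge_pos h0 (planePoint_ne_zero (Or.inr one_ne_zero))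
  have hPG : ∀ v ∈ Ioo (-(1 / 2) : ℝ) (1 / 2), P v = (G (v / √(1 - v ^ 2)))⁻¹ := fun v hv => by
    have hv2 : v ^ 2 < 1 / 4 := by nlinarith [hv.1, hv.2]
    have hs : 0 < √(1 - v ^ 2) := Real.sqrt_pos.2 (by linarith)
    have hw : v / √(1 - v ^ 2) ∈ Ioo (-1 : ℝ) 1 := by
      rw [mem_Ioo, ← abs_lt, ← sq_lt_one_iff_abs_lt_one, div_pow, Real.sq_sqrt (by linarith),
        div_lt_one (by linarith)]
      linarith
    have h1 : planePoint j v √(1 - v ^ 2) =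
        √(1 - v ^ 2) • planePoint j (v / √(1 - v ^ 2)) 1 := by
      rw [smul_planePoint, mul_div_cancel₀ _ hs.ne', mul_one]
    rw [← hG _ hw, hPdef, hq]
    simp only
    rw [h1, gauge_smul_of_nonneg hs.le, smul_eq_mul, mul_inv, mul_inv_cancel_left₀ hs.ne']
  have hsmall : ∀ η > 0, ∀ᶠ v in 𝓝 0, P 0 - P v ≤ η * v ^ 2 := fun η hη => by
    filter_upwards [eventually_inv_sub_inv_comp_le hG0 hGo hη,
      isOpen_Ioo.mem_nhds (show (0 : ℝ) ∈ Ioo (-(1 / 2) : ℝ) (1 / 2) by norm_num)] with v hv hv2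
    rw [hPG v hv2, hPG 0 (by norm_num), zero_div]
    exact hv
  have hV : Module.finrank ℝ (EuclideanSpace ℝ (Fin (j + 4))) = (j + 1) + 3 := by simp
  have hrad := radialFunction_eq_inv_gauge_planePoint hK h0 hface hg
  obtain ⟨C, hC⟩ := exists_ae_eq_const_of_forall_lintegral_eq (μ := μ)
    (s := fun ξ => √(1 - (ξ : EuclideanSpace ℝ (Fin (j + 4))) 0 ^ 2)) hj (by fun_prop)
    (fun ξ => ⟨Real.sqrt_nonneg _, Real.sqrt_le_one.2 (by
      nlinarith [sq_nonneg ((ξ : EuclideanSpace ℝ (Fin (j + 4))) 0)])⟩) hPc.measurable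
    hPc.continuousAt hPnonneg hsmall (zonalConst_ne_zero (j + 1)) (zonalConst_ne_top (j + 1))
    (zonalConst_ne_top j) (fun φ => by
      rw [← lintegral_zonal_eq_lintegral_radon hstar.continuous_radial
        (fun ξ => by rw [hrad]; exact inv_nonneg.2 (gauge_nonneg _)) hint φ]
      have hφ : Measurable fun v => (φ v : ℝ≥0∞) := by fun_prop
      have h2 := lintegral_surfaceMeasure_inner hV (e := EuclideanSpace.single 0 1) (by simp)
        (F := fun u => ENNReal.ofReal (q u)⁻¹ * φ u)
        ((hqc.measurable.inv.ennreal_ofReal).mul hφ)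
      have h3 : ∀ ξ : sphere (0 : EuclideanSpace ℝ (Fin (j + 4))) 1,
          ENNReal.ofReal (radialFunction K ξ) * φ ((ξ : EuclideanSpace ℝ (Fin (j + 4))) 0) =
          ENNReal.ofReal (q (inner ℝ (EuclideanSpace.single 0 1)
            (ξ : EuclideanSpace ℝ (Fin (j + 4)))))⁻¹ *
            φ (inner ℝ (EuclideanSpace.single 0 1) (ξ : EuclideanSpace ℝ (Fin (j + 4)))) :=
        fun ξ => by
          rw [hrad]
          simp [EuclideanSpace.inner_single_left, hq]
      rw [lintegral_congr h3, h2]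
      congr 1
      refine lintegral_congr fun u => ?_
      rw [← mul_assoc, ← ENNReal.ofReal_mul (by positivity)]
      congr 2
      simp only [hPdef]
      ring)
  -- Since 4/5 > 1/√2, these directions meet the cone over the face.
  have hPface : ∀ v ∈ Ioo (4 / 5 : ℝ) 1, P v = √(1 - v ^ 2) / v := fun v hv => by
    have hv0 : 0 < v := by linarith [hv.1]
    have h1 : q v = |planePoint j v √(1 - v ^ 2) 0| := by
      refine gauge_eq_abs_apply_zero (d := j + 3) hK h0 hface ?_
      rw [norm_yPart_planePoint, planePoint_apply_zero, abs_of_nonneg (Real.sqrt_nonneg _),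
        abs_of_pos hv0]
      exact Real.sqrt_le_left hv0.le |>.2 (by nlinarith [hv.1])
    rw [planePoint_apply_zero, abs_of_pos hv0] at h1
    simp only [hPdef]
    rw [h1, div_eq_mul_inv]
  -- P is only almost everywhere constant, so v < w are picked from disjoint intervals inside the
  -- face region.
  obtain ⟨v, hv, hvC⟩ := exists_mem_Ioo_of_ae_restrict hC (a := 4 / 5) (b := 9 / 10) (by norm_num)
    (Ioo_subset_Ioo (by norm_num) (by norm_num))
  obtain ⟨w, hw, hwC⟩ := exists_mem_Ioo_of_ae_restrict hC (a := 9 / 10) (b := 1) (by norm_num)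
    (Ioo_subset_Ioo (by norm_num) (by norm_num))
  rw [hPface v ⟨hv.1, by linarith [hv.2]⟩] at hvC
  rw [hPface w ⟨by linarith [hw.1], hw.2⟩, ← hvC] at hwC
  refine absurd hwC (ne_of_lt ?_)
  have hv1 : 0 < v := by linarith [hv.1]
  have hsq : √(1 - w ^ 2) < √(1 - v ^ 2) :=
    Real.sqrt_lt_sqrt (by nlinarith [hw.1, hw.2]) (by nlinarith [hv.2, hw.1])
  exact div_lt_div₀ hsq (by linarith [hv.2, hw.1]) (Real.sqrt_nonneg _) hv1
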